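/- Let $\mathcal T=(V,E)$ be a locally finite, infinite tree with root $\varrho$. For a vertex $x$ let $|x|$ be its graph distance to $\varrho$, and for an edge $e$ let $|e|$ be the distance to $\varrho$ of the endpoint of $e$ farther from $\varrho$. A set $\pi\subset E$ is a cutset if every infinite self-avoiding path starting at $\varrho$ has exactly one edge in $\pi$; let $\Pi$ be the set of all cutsets. Define the intermediate branching number $$\mathrm{IBN}(\mathcal T)=\sup\Big\{\lambda>0:\ \inf_{\pi\in\Pi}\sum_{e\in\pi}\exp(-|e|^{\lambda})>0\Big\}\in[0,\infty],$$ where $\sup\emptyset=0$. For real $\lambda$, let $\mathbf X=(X_n)_{n\ge0}$ be the random walk on $\mathcal T$ with conductances $c(e)=\exp(-|e|^{\lambda})$, $e\in E$, that is, the Markov chain with $X_0=\varrho$ which moves from a vertex $\mu$ to a neighbour $\nu$ with probability $c(\{\mu,\nu\})/\sum_{\nu'\sim\mu}c(\{\mu,\nu'\})$. If $\lambda>\mathrm{IBN}(\mathcal T)$, then $\mathbf X$ is recurrent: almost surely it visits $\varrho$ infinitely often. If $0<\lambda<\mathrm{IBN}(\mathcal T)$, then $\mathbf X$ is transient: almost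 surely it visits $\varrho$ only finitely often. -/

import Mathlib

open MeasureTheory ProbabilityTheory
open scoped ENNReal

noncomputable section

namespace RootedTree

variable {V : Type*}

/-- The distance `|e|` of an edge to the root `ρ`: the distance to `ρ` of the endpoint of `e`
that is farther from `ρ`. Thus `|e| = 1` for the edges at the root. -/
def edgeDepth (G : SimpleGraph V) (ρ : V) : Sym2 V → ℕ :=
  Sym2.lift ⟨fun x y => max (G.dist ρ x) (G.dist ρ y), fun _ _ => max_comm _ _⟩

/-- The weight `exp (-|e| ^ l)` of an edge. -/
def weight (G : SimpleGraph V) (ρ : V) (l : ℝ) (e : Sym2 V) : ℝ≥0∞ :=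
  ENNReal.ofReal (Real.exp (-(edgeDepth G ρ e : ℝ) ^ l))

/-- `f` is an infinite self-avoiding path of `G` that starts at `ρ`. -/
structure IsRay (G : SimpleGraph V) (ρ : V) (f : ℕ → V) : Prop where
  start : f 0 = ρ
  adj : ∀ n, G.Adj (f n) (f (n + 1))
  injective : Function.Injective f

/-- A cutset is a set of edges such that every infinite self-avoiding path from the root has
exactly one edge in it. -/
def IsCutset (G : SimpleGraph V) (ρ : V) (π : Set (Sym2 V)) : Prop :=
  π ⊆ G.edgeSet ∧
    ∀ f : ℕ → V, IsRay G ρ f → ∃! e : Sym2 V, e ∈ π ∧ ∃ n : ℕ, e = s(f n, f (n + 1))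

/-- The infimum over all cutsets `π` of `∑ e ∈ π, exp (-|e| ^ l)`. -/
def cutsetInf (G : SimpleGraph V) (ρ : V) (l : ℝ) : ℝ≥0∞ :=
  ⨅ (π : Set (Sym2 V)) (_ : IsCutset G ρ π), ∑' e : π, weight G ρ l e

/-- The intermediate branching number, with values in `[0, ∞]`; it is `0` if no `l > 0`
qualifies. -/
def IBN (G : SimpleGraph V) (ρ : V) : ℝ≥0∞ :=
  sSup (ENNReal.ofReal '' {l : ℝ | 0 < l ∧ 0 < cutsetInf G ρ l})

/-- The conductance `c` restricted to the edges from `x`, as a function of the other endpoint. -/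
def edgeCond (G : SimpleGraph V) (c : Sym2 V → ℝ≥0∞) (x y : V) : ℝ≥0∞ :=
  open Classical in if G.Adj x y then c s(x, y) else 0

/-- One step of the random walk on `G` with conductances `c`: from `x`, jump to a neighbour `y`
with probability `c(x, y) / ∑ z ~ x, c(x, z)`. (The walk stays put at `x` if this sum is `0` or
infinite, which does not happen when `x` has finitely many neighbours, and at least one, and all
conductances are positive and finite.) -/
def step (G : SimpleGraph V) (c : Sym2 V → ℝ≥0∞) (x : V) : PMF V :=
  open Classical in
  if h : ∑' y, edgeCond G c x y ≠ 0 ∧ ∑' y, edgeCond G c x y ≠ ∞ then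
    PMF.normalize (edgeCond G c x) h.1 h.2
  else PMF.pure x

variable [MeasurableSpace V] [DiscreteMeasurableSpace V]

/-- The transition kernel of the random walk. -/
def stepKernel (G : SimpleGraph V) (c : Sym2 V → ℝ≥0∞) : Kernel V V where
  toFun x := (step G c x).toMeasure
  measurable' := .of_discrete

instance (G : SimpleGraph V) (c : Sym2 V → ℝ≥0∞) : IsMarkovKernel (stepKernel G c) :=
  ⟨fun x => inferInstanceAs (IsProbabilityMeasure (step G c x).toMeasure)⟩

/-- The kernel giving the law of `X (n + 1)` given `X 0, …, X n`: it depends on `X n` only. -/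
def historyKernel (G : SimpleGraph V) (c : Sym2 V → ℝ≥0∞) (n : ℕ) :
    Kernel ((i : Finset.Iic n) → V) V :=
  (stepKernel G c).comap (fun x => x ⟨n, Finset.mem_Iic.2 le_rfl⟩) (measurable_pi_apply _)

instance (G : SimpleGraph V) (c : Sym2 V → ℝ≥0∞) (n : ℕ) :
    IsMarkovKernel (historyKernel G c n) := by
  unfold historyKernel; infer_instance

/-- The law, on trajectories `ℕ → V`, of the random walk on `G` with conductances `c` that
starts at `ρ`. -/
def walkLaw (G : SimpleGraph V) (c : Sym2 V → ℝ≥0∞) (ρ : V) : Measure (ℕ → V) :=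
  Kernel.trajMeasure (X := fun _ => V) (Measure.dirac ρ) (historyKernel G c)

/-- Almost surely, the walk visits its starting point infinitely often. -/
def IsRecurrent (G : SimpleGraph V) (c : Sym2 V → ℝ≥0∞) (ρ : V) : Prop :=
  ∀ᵐ X ∂(walkLaw G c ρ), {n : ℕ | X n = ρ}.Infinite

/-- Almost surely, the walk visits its starting point only finitely often. -/
def IsTransient (G : SimpleGraph V) (c : Sym2 V → ℝ≥0∞) (ρ : V) : Prop :=
  ∀ᵐ X ∂(walkLaw G c ρ), {n : ℕ | X n = ρ}.Finite

end RootedTree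

end

/-!
The conductances are `exp (-|e| ^ l)`, so that the distance to the root enters only through the
conductance of an edge, and both halves of the theorem compare harmonic functions on the tree with
flows. A function on the vertices has a gradient, which assigns to each vertex `x ≠ ρ` the current
`cond x * (h x - h (parent x))` through the edge from its parent, and `h` is harmonic at `x` exactly
if the current into `x` equals the sum of the currents into its children.

*Recurrence.* If `l` exceeds the intermediate branching number, then there are cutsets of
arbitrarily small total conductance. The probability `escape x` of never visiting `ρ` from `x` is
harmonic off `ρ` and grows along rays (`noVisit_parent_le`), so its gradient is a nonnegative flow,
bounded by the conductances. Such a flow has strength at most the total conductance of any cutset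
(`sum_flow_le_cutset`). Hence it vanishes, and so does `escape`; by the Markov property the walk
has no last visit to `ρ` (`isRecurrent_of_escape_eq_zero`).

*Transience.* If `l` is below the intermediate branching number, then some `l' > l` has
`cutsetInf l' > 0`, and max-flow min-cut on the tree gives a nonzero flow `θ` to infinity with
`θ ≤ exp (-|e| ^ l')` (`exists_flow_of_cutsetInf_pos`). Integrate it against the resistances
`exp (|e| ^ l)` along the path from the root: the resulting function `h` is harmonic off the root
for the walk with exponent `l`, it is bounded because `∑ exp (n ^ l - n ^ l')` converges, and at the
root its mean over the neighbours exceeds its value. So `B - h`, with `B` an upper bound of `h`, is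
a nonnegative superharmonic function that is not harmonic at the root; this bounds the expected
number of visits to the root (`isTransient_of_superharmonic`), and Borel-Cantelli applies.
-/

namespace RootedTree

variable {V : Type*} {G : SimpleGraph V} {ρ : V}

/-! ### Parents and children -/

section Tree

/-- The neighbour of `x` that is closer to `ρ`; by convention, `parent G ρ ρ = ρ`. -/
noncomputable def parent (G : SimpleGraph V) (ρ x : V) : V :=
  open Classical in
  if h : ∃ p, G.Adj p x ∧ G.dist ρ x = G.dist ρ p + 1 then h.choose else x

/-- The neighbours of `x` that are farther from `ρ`. -/
noncomputable def children (G : SimpleGraph V) [G.LocallyFinite] (ρ x : V) : Finset V :=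
  (G.neighborFinset x).filter fun y => G.dist ρ y = G.dist ρ x + 1

lemma parent_root : parent G ρ ρ = ρ := by
  have : ¬ ∃ p, G.Adj p ρ ∧ G.dist ρ ρ = G.dist ρ p + 1 := by simp
  rw [parent, dif_neg this]

/-- Both neighbours extend to a shortest path from `ρ` to `x`, and such a path is unique. -/
lemma eq_of_adj_of_dist_eq (hG : G.IsTree) {x p q : V} (hp : G.Adj p x)
    (hpd : G.dist ρ x = G.dist ρ p + 1) (hq : G.Adj q x)
    (hqd : G.dist ρ x = G.dist ρ q + 1) : p = q := by
  have key : ∀ r, G.Adj r x → G.dist ρ x = G.dist ρ r + 1 →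
      ∃ w : G.Walk ρ x, w.IsPath ∧ w.penultimate = r := by
    intro r hr hrd
    obtain ⟨w, hw⟩ := hG.connected.exists_walk_length_eq_dist ρ r
    refine ⟨w.concat hr, ?_, by simp⟩
    apply SimpleGraph.Walk.isPath_of_length_eq_dist
    simp [hw, hrd]
  obtain ⟨w, hw, rfl⟩ := key p hp hpd
  obtain ⟨w', hw', rfl⟩ := key q hq hqd
  have := (hG.isAcyclic.subsingleton_path ρ x).elim ⟨w, hw⟩ ⟨w', hw'⟩
  rw [Subtype.mk.injEq] at this
  rw [this]

lemma exists_parent (hG : G.IsTree) {x : V} (hx : x ≠ ρ) :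
    ∃ p, G.Adj p x ∧ G.dist ρ x = G.dist ρ p + 1 := by
  obtain ⟨w, hw⟩ := hG.connected.exists_walk_length_eq_dist ρ x
  have hnil : ¬ w.Nil := fun h => hx h.eq.symm
  have hadj := w.adj_penultimate hnil
  refine ⟨w.penultimate, hadj, ?_⟩
  have h1 : G.dist ρ w.penultimate ≤ w.length - 1 := by
    refine (SimpleGraph.dist_le w.dropLast).trans ?_
    simp
  have h2 : 0 < w.length := by
    rw [Nat.pos_iff_ne_zero]
    exact fun h => hnil (SimpleGraph.Walk.length_eq_zero_iff.1 h)
  have h3 := hG.dist_eq_dist_add_one_of_adj ρ hadj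
  omega

lemma parent_spec (hG : G.IsTree) {x : V} (hx : x ≠ ρ) :
    G.Adj (parent G ρ x) x ∧ G.dist ρ x = G.dist ρ (parent G ρ x) + 1 := by
  have h := exists_parent hG hx
  rw [parent, dif_pos h]
  exact h.choose_spec

lemma parent_eq (hG : G.IsTree) {x p : V} (hp : G.Adj p x)
    (hpd : G.dist ρ x = G.dist ρ p + 1) : parent G ρ x = p := by
  have hx : x ≠ ρ := by rintro rfl; simp at hpd
  exact eq_of_adj_of_dist_eq hG (parent_spec hG hx).1 (parent_spec hG hx).2 hp hpd

lemma dist_parent (hG : G.IsTree) (x : V) : G.dist ρ (parent G ρ x) = G.dist ρ x - 1 := by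
  by_cases hx : x = ρ
  · subst hx; simp [parent_root]
  · have := (parent_spec hG hx).2
    omega

lemma dist_iterate_parent (hG : G.IsTree) (k : ℕ) (x : V) :
    G.dist ρ ((parent G ρ)^[k] x) = G.dist ρ x - k := by
  induction k with
  | zero => simp
  | succ k ih => rw [Function.iterate_succ_apply', dist_parent hG, ih]; omega

lemma eq_root_of_dist_eq_zero (hG : G.IsTree) {x : V} (h : G.dist ρ x = 0) : x = ρ :=
  ((hG.connected.dist_eq_zero_iff).1 h).symm

variable [G.LocallyFinite]

lemma mem_children (hG : G.IsTree) {x y : V} :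
    y ∈ children G ρ x ↔ y ≠ ρ ∧ parent G ρ y = x := by
  simp only [children, Finset.mem_filter, SimpleGraph.mem_neighborFinset]
  constructor
  · rintro ⟨h1, h2⟩
    exact ⟨by rintro rfl; simp at h2, parent_eq hG h1 h2⟩
  · rintro ⟨h1, rfl⟩
    exact parent_spec hG h1

lemma dist_of_mem_children {x y : V} (h : y ∈ children G ρ x) :
    G.dist ρ y = G.dist ρ x + 1 := by
  simp only [children, Finset.mem_filter] at h
  exact h.2

lemma adj_of_mem_children {x y : V} (h : y ∈ children G ρ x) : G.Adj x y := by
  simp only [children, Finset.mem_filter, SimpleGraph.mem_neighborFinset] at h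
  exact h.1

lemma parent_notMem_children (hG : G.IsTree) (x : V) : parent G ρ x ∉ children G ρ x := by
  intro h
  have h1 := dist_of_mem_children h
  rw [dist_parent hG] at h1
  omega

lemma neighborFinset_root (hG : G.IsTree) : G.neighborFinset ρ = children G ρ ρ := by
  ext y
  simp only [children, Finset.mem_filter, SimpleGraph.mem_neighborFinset, iff_self_and]
  intro h
  have := hG.dist_eq_dist_add_one_of_adj ρ h
  simp at this ⊢
  omega

lemma neighborFinset_eq_cons (hG : G.IsTree) {x : V} (hx : x ≠ ρ) :
    G.neighborFinset x = Finset.cons (parent G ρ x) (children G ρ x)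
      (parent_notMem_children hG x) := by
  ext y
  simp only [Finset.mem_cons]
  constructor
  · intro h
    rw [SimpleGraph.mem_neighborFinset] at h
    rcases hG.dist_eq_dist_add_one_of_adj ρ h with h1 | h1
    · exact Or.inl (parent_eq hG h.symm h1).symm
    · exact Or.inr (by simp [children, h, h1])
  · rintro (rfl | h)
    · simpa using (parent_spec hG hx).1.symm
    · simpa using adj_of_mem_children h

/-! ### Rays -/

/-- A ray moves away from the root at every step: the only way back is to the vertex it has just
left. -/
lemma IsRay.dist_eq (hG : G.IsTree) {f : ℕ → V} (hf : IsRay G ρ f) (n : ℕ) :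
    G.dist ρ (f n) = n ∧ f (n + 1) ∈ children G ρ (f n) := by
  induction n with
  | zero =>
    have := hf.adj 0
    rw [← SimpleGraph.mem_neighborFinset] at this
    rw [hf.start] at this ⊢
    rw [neighborFinset_root hG] at this
    exact ⟨by simp, this⟩
  | succ n ih =>
    have h1 : G.dist ρ (f (n + 1)) = n + 1 := by rw [dist_of_mem_children ih.2, ih.1]
    refine ⟨h1, ?_⟩
    have h2 := hf.adj (n + 1)
    have h3 := ((mem_children hG).1 ih.2)
    rw [← SimpleGraph.mem_neighborFinset, neighborFinset_eq_cons hG h3.1,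
      Finset.mem_cons] at h2
    refine h2.resolve_left fun h4 => ?_
    rw [h3.2] at h4
    have := hf.injective h4
    omega

lemma isRay_of_mem_children {f : ℕ → V} (h0 : f 0 = ρ)
    (h : ∀ n, f (n + 1) ∈ children G ρ (f n)) : IsRay G ρ f := by
  have hd : ∀ n, G.dist ρ (f n) = n := by
    intro n
    induction n with
    | zero => simp [h0]
    | succ n ih => rw [dist_of_mem_children (h n), ih]
  exact ⟨h0, fun n => adj_of_mem_children (h n), fun a b hab => by rw [← hd a, hab, hd b]⟩

lemma IsRay.iterate_parent (hG : G.IsTree) {f : ℕ → V} (hf : IsRay G ρ f) (n k : ℕ) :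
    (parent G ρ)^[k] (f (n + k)) = f n := by
  induction k with
  | zero => rfl
  | succ k ih =>
    rw [Function.iterate_succ_apply, ← add_assoc,
      ((mem_children hG).1 (hf.dist_eq hG (n + k)).2).2, ih]

/-! ### Sums over subtrees -/

/-- `z` lies in the subtree rooted at `x`. If `z` is closer to the root than `x`, truncated
subtraction makes the exponent `0`, and the condition fails because it reads `z = x`. -/
def Below (G : SimpleGraph V) (ρ x z : V) : Prop :=
  (parent G ρ)^[G.dist ρ z - G.dist ρ x] z = x

/-- The sum of `w` over the subtree rooted at `x`. -/
noncomputable def subtreeSum (G : SimpleGraph V) (ρ : V) (w : V → ℝ≥0∞) (x : V) : ℝ≥0∞ :=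
  ∑' z, {z | Below G ρ x z}.indicator w z

omit [G.LocallyFinite] in
lemma below_refl (x : V) : Below G ρ x x := by simp [Below]

omit [G.LocallyFinite] in
lemma below_root (hG : G.IsTree) (z : V) : Below G ρ ρ z := by
  apply eq_root_of_dist_eq_zero hG
  rw [dist_iterate_parent hG]
  simp

lemma below_of_mem_children (hG : G.IsTree) {x y z : V} (hy : y ∈ children G ρ x)
    (h : Below G ρ y z) : Below G ρ x z ∧ z ≠ x := by
  have hd := dist_of_mem_children hy
  have hlt : G.dist ρ y ≤ G.dist ρ z := by
    by_contra! hlt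
    rw [Below, Nat.sub_eq_zero_of_le hlt.le] at h
    simp only [Function.iterate_zero, id_eq] at h
    rw [h] at hlt
    exact lt_irrefl _ hlt
  constructor
  · have h1 : G.dist ρ z - G.dist ρ x = (G.dist ρ z - G.dist ρ y) + 1 := by omega
    rw [Below] at h ⊢
    rw [h1, Function.iterate_succ_apply', h]
    exact ((mem_children hG).1 hy).2
  · rintro rfl
    omega

lemma exists_child_below (hG : G.IsTree) {x z : V} (h : Below G ρ x z) (hz : z ≠ x) :
    ∃ y ∈ children G ρ x, ∀ y' ∈ children G ρ x, Below G ρ y' z ↔ y' = y := by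
  have hlt : G.dist ρ x < G.dist ρ z := by
    by_contra! hlt
    rw [Below, Nat.sub_eq_zero_of_le hlt] at h
    exact hz h
  obtain ⟨k, hk⟩ : ∃ k, G.dist ρ z - G.dist ρ x = k + 1 := ⟨G.dist ρ z - G.dist ρ x - 1, by omega⟩
  refine ⟨(parent G ρ)^[k] z, ?_, ?_⟩
  · rw [mem_children hG]
    rw [Below, hk, Function.iterate_succ_apply'] at h
    refine ⟨fun h0 => ?_, h⟩
    have := dist_iterate_parent (ρ := ρ) hG k z
    rw [h0, SimpleGraph.dist_self] at this
    omega
  · intro y' hy'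
    have := dist_of_mem_children hy'
    rw [Below, show G.dist ρ z - G.dist ρ y' = k by omega, eq_comm]

/-- A subtree is made up of its root and of the subtrees at the children of its root. -/
lemma subtreeSum_eq (hG : G.IsTree) (w : V → ℝ≥0∞) (x : V) :
    subtreeSum G ρ w x = w x + ∑ y ∈ children G ρ x, subtreeSum G ρ w y := by
  classical
  simp only [subtreeSum]
  rw [← Summable.tsum_finsetSum (fun _ _ => ENNReal.summable), ← tsum_ite_eq x w,
    ← ENNReal.tsum_add]
  refine tsum_congr fun z => ?_
  by_cases hzx : z = x
  · subst hzx
    rw [if_pos rfl, Set.indicator_of_mem (Set.mem_ofPred.2 (below_refl z)),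
      Finset.sum_eq_zero, add_zero]
    exact fun y hy => Set.indicator_of_notMem
      (mt Set.mem_ofPred.1 fun h => (below_of_mem_children hG hy h).2 rfl) _
  · rw [if_neg hzx, zero_add]
    by_cases hb : Below G ρ x z
    · obtain ⟨y, hy, hy'⟩ := exists_child_below hG hb hzx
      rw [Finset.sum_eq_single_of_mem y hy, Set.indicator_of_mem (Set.mem_ofPred.2 hb),
        Set.indicator_of_mem]
      · exact (hy' y hy).2 rfl
      · exact fun b hb' hne => Set.indicator_of_notMem
          (mt Set.mem_ofPred.1 fun h => hne ((hy' b hb').1 h)) _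
    · rw [Set.indicator_of_notMem (mt Set.mem_ofPred.1 hb), Finset.sum_eq_zero]
      exact fun y hy => Set.indicator_of_notMem
        (mt Set.mem_ofPred.1 fun h => hb (below_of_mem_children hG hy h).1) _

/-! ### Cutsets as sets of vertices -/

/-- The edge that joins `x` to its parent. -/
noncomputable def edgeTo (G : SimpleGraph V) (ρ x : V) : Sym2 V := s(parent G ρ x, x)

omit [G.LocallyFinite] in
lemma edgeDepth_edgeTo (hG : G.IsTree) (x : V) : edgeDepth G ρ (edgeTo G ρ x) = G.dist ρ x := by
  simp [edgeDepth, edgeTo, dist_parent hG]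

omit [G.LocallyFinite] in
lemma edgeTo_injOn (hG : G.IsTree) : Set.InjOn (edgeTo G ρ) {ρ}ᶜ := by
  intro x hx y hy h
  have h1 := (parent_spec hG hx).2
  have h2 := (parent_spec hG hy).2
  rw [edgeTo, edgeTo, Sym2.eq_iff] at h
  rcases h with h | h
  · exact h.2
  · rw [h.1] at h1
    rw [← h.2] at h2
    omega

omit [G.LocallyFinite] in
lemma edgeSet_eq_image (hG : G.IsTree) : G.edgeSet = edgeTo G ρ '' {ρ}ᶜ := by
  ext e
  induction e using Sym2.ind with
  | h x y =>
  rw [SimpleGraph.mem_edgeSet]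
  constructor
  · intro h
    rcases hG.dist_eq_dist_add_one_of_adj ρ h with h1 | h1
    · refine ⟨x, ?_, ?_⟩
      · rintro rfl; simp at h1
      · rw [edgeTo, parent_eq hG h.symm h1, Sym2.eq_swap]
    · refine ⟨y, ?_, ?_⟩
      · rintro rfl; simp at h1
      · rw [edgeTo, parent_eq hG h h1]
  · rintro ⟨z, hz, h⟩
    rw [← SimpleGraph.mem_edgeSet, ← h]
    exact (parent_spec hG hz).1

lemma IsRay.edgeTo_eq (hG : G.IsTree) {f : ℕ → V} (hf : IsRay G ρ f) (n : ℕ) :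
    edgeTo G ρ (f (n + 1)) = s(f n, f (n + 1)) := by
  rw [edgeTo, ((mem_children hG).1 (hf.dist_eq hG n).2).2]

/-- As the edges of a tree correspond to the vertices other than the root, a cutset is given by the
set `C` of the far endpoints of its edges. -/
lemma isCutset_image_iff (hG : G.IsTree) {C : Set V} (hC : C ⊆ {ρ}ᶜ) :
    IsCutset G ρ (edgeTo G ρ '' C) ↔ ∀ f, IsRay G ρ f → ∃! n : ℕ, f (n + 1) ∈ C := by
  rw [IsCutset, and_iff_right (by rw [edgeSet_eq_image hG]; exact Set.image_mono hC)]
  refine forall₂_congr fun f hf => ?_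
  have hne : ∀ n, f (n + 1) ∈ ({ρ}ᶜ : Set V) :=
    fun n => ((mem_children hG).1 (hf.dist_eq hG n).2).1
  have hmem : ∀ n, s(f n, f (n + 1)) ∈ edgeTo G ρ '' C ↔ f (n + 1) ∈ C := by
    intro n
    rw [← hf.edgeTo_eq hG]
    exact (edgeTo_injOn hG).mem_image_iff hC (hne n)
  constructor
  · rintro ⟨e, ⟨he, n, rfl⟩, hu⟩
    refine ⟨n, (hmem n).1 he, fun k hk => ?_⟩
    have := hu s(f k, f (k + 1)) ⟨(hmem k).2 hk, k, rfl⟩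
    rw [← hf.edgeTo_eq hG, ← hf.edgeTo_eq hG] at this
    have := hf.injective (edgeTo_injOn hG (hne k) (hne n) this)
    omega
  · rintro ⟨n, hn, hu⟩
    refine ⟨s(f n, f (n + 1)), ⟨(hmem n).2 hn, n, rfl⟩, ?_⟩
    rintro e ⟨he, k, rfl⟩
    rw [hu k ((hmem k).1 he)]

omit [G.LocallyFinite] in
lemma tsum_edgeTo_image (hG : G.IsTree) {C : Set V} (hC : C ⊆ {ρ}ᶜ) (c : Sym2 V → ℝ≥0∞) :
    ∑' e : edgeTo G ρ '' C, c e = subtreeSum G ρ (C.indicator fun x => c (edgeTo G ρ x)) ρ := by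
  rw [tsum_image c ((edgeTo_injOn hG).mono hC), tsum_subtype C (fun x => c (edgeTo G ρ x)),
    subtreeSum]
  refine tsum_congr fun z => ?_
  rw [Set.indicator_of_mem (s := {z | Below G ρ ρ z}) (below_root hG z)]

end Tree

/-! ### The random walk -/

section Walk

variable [MeasurableSpace V] [DiscreteMeasurableSpace V] {c : Sym2 V → ℝ≥0∞}

instance : IsProbabilityMeasure (walkLaw G c ρ) := by
  unfold walkLaw; infer_instance

omit [DiscreteMeasurableSpace V] in
lemma measurable_frestrictLe_prod (n : ℕ) :
    Measurable fun X : ℕ → V => (Preorder.frestrictLe (π := fun _ => V) n X, X (n + 1)) := by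
  fun_prop

/-- The Markov property at time `n`, in integrated form. -/
lemma lintegral_walkLaw_succ (n : ℕ) {F : ((i : Finset.Iic n) → V) → ℝ≥0∞} (hF : Measurable F)
    (g : V → ℝ≥0∞) :
    ∫⁻ X, F (Preorder.frestrictLe (π := fun _ => V) n X) * g (X (n + 1)) ∂(walkLaw G c ρ) =
      ∫⁻ X, F (Preorder.frestrictLe (π := fun _ => V) n X) * ∫⁻ y, g y ∂(stepKernel G c (X n))
        ∂(walkLaw G c ρ) := by
  have hg : Measurable g := .of_discrete
  have h := Kernel.map_frestrictLe_trajMeasure_compProd_eq_map_trajMeasure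
    (X := fun _ => V) (μ₀ := Measure.dirac ρ) (κ := historyKernel G c) (a := n)
  have hH : Measurable fun p : ((i : Finset.Iic n) → V) × V => F p.1 * g p.2 := by fun_prop
  have h1 := lintegral_map hH (measurable_frestrictLe_prod (V := V) n) (μ := walkLaw G c ρ)
  rw [walkLaw, ← h, Measure.lintegral_compProd hH, lintegral_map] at h1
  · rw [walkLaw, ← h1]
    refine lintegral_congr fun X => ?_
    exact lintegral_const_mul (F (Preorder.frestrictLe (π := fun _ => V) n X)) hg
  · exact hH.lintegral_kernel_prod_right'
  · fun_prop

lemma walkLaw_zero : ∀ᵐ X ∂(walkLaw G c ρ), X 0 = ρ := by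
  have h : (walkLaw G c ρ).map (Preorder.frestrictLe (π := fun _ => V) 0) =
      (Measure.dirac ρ).map (MeasurableEquiv.piUnique fun _ : Finset.Iic 0 => V).symm := by
    rw [walkLaw, Kernel.trajMeasure, Measure.map_comp _ _ (by fun_prop),
      Kernel.traj_map_frestrictLe, Kernel.partialTraj_self, Measure.id_comp]
  rw [Measure.map_dirac' (by fun_prop)] at h
  have hmeas : MeasurableSet {x : (i : Finset.Iic 0) → V | x ⟨0, by simp⟩ = ρ} := by
    have h0 : Measurable fun x : (i : Finset.Iic 0) → V => x ⟨0, by simp⟩ := by fun_prop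
    exact h0 (MeasurableSet.of_discrete (s := {ρ}))
  have h2 : ∀ᵐ x ∂((walkLaw G c ρ).map (Preorder.frestrictLe (π := fun _ => V) 0)),
      x ⟨0, by simp⟩ = ρ := by
    rw [h, ae_dirac_iff hmeas]
    rfl
  exact ae_of_ae_map (by fun_prop) h2

lemma lintegral_eval_succ (n : ℕ) (g : V → ℝ≥0∞) :
    ∫⁻ X, g (X (n + 1)) ∂(walkLaw G c ρ) =
      ∫⁻ X, ∫⁻ y, g y ∂(stepKernel G c (X n)) ∂(walkLaw G c ρ) := by
  simpa using lintegral_walkLaw_succ (c := c) (G := G) (ρ := ρ) n (F := fun _ => 1)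
    measurable_const g

/-- The walk is transient as soon as there is a finite superharmonic function that is not harmonic
at the root: along the walk its mean decreases by a fixed multiple of the probability of being at
the root, so the expected number of visits to the root is finite. -/
lemma isTransient_of_superharmonic (f : V → ℝ≥0∞) (hf : f ρ ≠ ∞) {ε : ℝ≥0∞} (hε : ε ≠ 0)
    (h : ∀ x, ({ρ} : Set V).indicator (fun _ => ε) x + ∫⁻ y, f y ∂(stepKernel G c x) ≤ f x) :
    IsTransient G c ρ := by
  have hm (n : ℕ) : MeasurableSet {X : ℕ → V | X n = ρ} := by
    have h0 : Measurable fun X : ℕ → V => X n := by fun_prop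
    exact h0 (MeasurableSet.of_discrete (s := {ρ}))
  have hstep (n : ℕ) : ε * walkLaw G c ρ {X | X n = ρ} + ∫⁻ X, f (X (n + 1)) ∂(walkLaw G c ρ) ≤
      ∫⁻ X, f (X n) ∂(walkLaw G c ρ) := by
    rw [lintegral_eval_succ, ← lintegral_indicator_const (hm n), ← lintegral_add_left]
    · exact lintegral_mono fun X => h (X n)
    · exact measurable_const.indicator (hm n)
  have hsum (n : ℕ) : ∑ k ∈ Finset.range n, ε * walkLaw G c ρ {X | X k = ρ} +
      ∫⁻ X, f (X n) ∂(walkLaw G c ρ) ≤ f ρ := by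
    induction n with
    | zero =>
      have : ∫⁻ X, f (X 0) ∂(walkLaw G c ρ) = ∫⁻ _, f ρ ∂(walkLaw G c ρ) :=
        lintegral_congr_ae (walkLaw_zero.mono fun X hX => congrArg f hX)
      simp [this]
    | succ n ih =>
      rw [Finset.sum_range_succ, add_assoc]
      exact (add_le_add_right (hstep n) _).trans ih
  have hfin : ∑' n, walkLaw G c ρ {X | X n = ρ} ≠ ∞ := by
    intro htop
    have h1 : ∑' n, ε * walkLaw G c ρ {X | X n = ρ} ≤ f ρ := by
      rw [ENNReal.tsum_eq_iSup_nat]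
      exact iSup_le fun n => le_self_add.trans (hsum n)
    rw [ENNReal.tsum_mul_left, htop, ENNReal.mul_top hε] at h1
    exact hf (top_le_iff.1 h1)
  exact ae_finite_setOfPred_mem hfin

/-! ### Avoiding the root -/

/-- The probability that the walk started at `x` does not visit `ρ` at the times `0, …, n`. -/
noncomputable def noVisit (G : SimpleGraph V) (c : Sym2 V → ℝ≥0∞) (ρ : V) : ℕ → V → ℝ≥0∞
  | 0 => ({ρ}ᶜ : Set V).indicator fun _ => 1
  | n + 1 => ({ρ}ᶜ : Set V).indicator fun x => ∫⁻ y, noVisit G c ρ n y ∂(stepKernel G c x)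

lemma noVisit_root (n : ℕ) : noVisit G c ρ n ρ = 0 := by
  cases n <;> simp [noVisit]

lemma noVisit_succ (n : ℕ) {x : V} (hx : x ≠ ρ) :
    noVisit G c ρ (n + 1) x = ∫⁻ y, noVisit G c ρ n y ∂(stepKernel G c x) := by
  simp [noVisit, hx]

lemma noVisit_le_one (n : ℕ) (x : V) : noVisit G c ρ n x ≤ 1 := by
  induction n generalizing x with
  | zero => exact Set.indicator_le_self' (fun _ _ => zero_le) x
  | succ n ih =>
    by_cases hx : x = ρ
    · rw [hx, noVisit_root]; exact zero_le
    · rw [noVisit_succ n hx]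
      exact (lintegral_mono ih).trans (by simp)

lemma noVisit_succ_le (n : ℕ) (x : V) : noVisit G c ρ (n + 1) x ≤ noVisit G c ρ n x := by
  induction n generalizing x with
  | zero =>
    by_cases hx : x = ρ
    · simp [hx, noVisit_root]
    · refine (noVisit_le_one 1 x).trans ?_
      simp [noVisit, hx]
  | succ n ih =>
    by_cases hx : x = ρ
    · simp [hx, noVisit_root]
    · rw [noVisit_succ _ hx, noVisit_succ _ hx]
      exact lintegral_mono ih

lemma noVisit_antitone : Antitone (noVisit G c ρ) :=
  antitone_nat_of_succ_le fun n x => noVisit_succ_le n x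

/-- The probability that the walk started at `x` never visits `ρ`. -/
noncomputable def escape (G : SimpleGraph V) (c : Sym2 V → ℝ≥0∞) (ρ x : V) : ℝ≥0∞ :=
  ⨅ n, noVisit G c ρ n x

lemma escape_root : escape G c ρ ρ = 0 := by simp [escape, noVisit_root]

lemma escape_le_one (x : V) : escape G c ρ x ≤ 1 := (iInf_le _ 0).trans (noVisit_le_one 0 x)

lemma escape_ne_top (x : V) : escape G c ρ x ≠ ∞ :=
  ne_top_of_le_ne_top ENNReal.one_ne_top (escape_le_one x)

lemma lintegral_escape (μ : Measure V) [IsFiniteMeasure μ] :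
    ∫⁻ x, escape G c ρ x ∂μ = ⨅ n, ∫⁻ x, noVisit G c ρ n x ∂μ := by
  refine lintegral_iInf (fun n => .of_discrete) noVisit_antitone (ne_of_lt ?_)
  exact ((lintegral_mono (noVisit_le_one 0)).trans_eq lintegral_one).trans_lt (measure_lt_top μ _)

/-- The escape probability is harmonic off the root. -/
lemma lintegral_escape_eq {x : V} (hx : x ≠ ρ) :
    ∫⁻ y, escape G c ρ y ∂(stepKernel G c x) = escape G c ρ x := by
  rw [lintegral_escape, escape]
  refine le_antisymm (le_iInf fun n => ?_) (le_iInf fun n => ?_)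
  · refine (iInf_le _ n).trans ?_
    rw [← noVisit_succ n hx]
    exact noVisit_succ_le n x
  · refine (iInf_le _ (n + 1)).trans ?_
    rw [noVisit_succ n hx]

/-- By the Markov property, the event of not visiting `ρ` from time `n` on is contained in the
event of not visiting it at the times `n, …, m - 1` and then at `k + 1` further times, whose
probability is the integral on the right. The induction on `k` moves one step from `noVisit` to the
indicator. -/
lemma measure_forall_ne_le (n k m : ℕ) (hnm : n ≤ m) :
    walkLaw G c ρ {X | ∀ i, n ≤ i → X i ≠ ρ} ≤
      ∫⁻ X, {X | ∀ i, n ≤ i → i < m → X i ≠ ρ}.indicator 1 X * noVisit G c ρ k (X m)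
        ∂(walkLaw G c ρ) := by
  classical
  induction k generalizing m with
  | zero =>
    have hA : MeasurableSet {X : ℕ → V | ∀ i, n ≤ i → X i ≠ ρ} := by
      have : {X : ℕ → V | ∀ i, n ≤ i → X i ≠ ρ} =
          ⋂ i, ⋂ _ : n ≤ i, (fun X => X i) ⁻¹' ({ρ}ᶜ : Set V) := by
        ext X; simp
      rw [this]
      exact .iInter fun i => .iInter fun _ => measurable_pi_apply i .of_discrete
    rw [← lintegral_indicator_one hA]
    refine lintegral_mono fun X => ?_
    by_cases hX : ∀ i, n ≤ i → X i ≠ ρ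
    · have hX' : ∀ i, n ≤ i → i < m → X i ≠ ρ := fun i h _ => hX i h
      rw [Set.indicator_of_mem (Set.mem_ofPred.2 hX), Set.indicator_of_mem (Set.mem_ofPred.2 hX')]
      simp [noVisit, hX m hnm]
    · rw [Set.indicator_of_notMem (mt Set.mem_ofPred.1 hX)]
      exact zero_le
  | succ k ih =>
    refine (ih (m + 1) (by omega)).trans_eq ?_
    -- The event of avoiding `ρ` at the times `n, …, m`, as a condition on the trajectory up to `m`.
    set S : Set ((i : Finset.Iic m) → V) := {x | ∀ i, n ≤ i.1 → x i ≠ ρ}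
    have hS : MeasurableSet S := by
      have : S = ⋂ i : Finset.Iic m, ⋂ _ : n ≤ i.1, (fun x => x i) ⁻¹' ({ρ}ᶜ : Set V) := by
        ext x; simp [S]
      rw [this]
      exact .iInter fun i => .iInter fun _ => measurable_pi_apply i .of_discrete
    have hF : Measurable (S.indicator (1 : ((i : Finset.Iic m) → V) → ℝ≥0∞)) :=
      measurable_one.indicator hS
    have hmemS : ∀ X : ℕ → V, Preorder.frestrictLe (π := fun _ => V) m X ∈ S ↔
        ∀ i, n ≤ i → i < m + 1 → X i ≠ ρ := by
      intro X
      simp only [S, Set.mem_ofPred, Preorder.frestrictLe_apply]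
      constructor
      · intro h i h1 h2
        exact h ⟨i, Finset.mem_Iic.2 (by omega)⟩ h1
      · rintro h ⟨i, hi⟩ h1
        exact h i h1 (by have := Finset.mem_Iic.1 hi; omega)
    have := lintegral_walkLaw_succ (G := G) (c := c) (ρ := ρ) m hF (noVisit G c ρ k)
    convert this using 1
    · refine lintegral_congr fun X => ?_
      congr 1
      simp only [Set.indicator_apply, hmemS, Set.mem_ofPred, Pi.one_apply]
    · refine lintegral_congr fun X => ?_
      simp only [Set.indicator_apply, hmemS, Set.mem_ofPred, Pi.one_apply]
      by_cases hX : X m = ρ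
      · rw [hX, noVisit_root, mul_zero, if_neg, zero_mul]
        exact fun h => h m hnm (Nat.lt_succ_self m) hX
      · rw [noVisit_succ k hX]
        congr 2
        rw [eq_iff_iff]
        refine ⟨fun h i h1 h2 => ?_, fun h i h1 h2 => h i h1 (by omega)⟩
        rcases Nat.lt_succ_iff_lt_or_eq.1 h2 with h3 | rfl
        · exact h i h1 h3
        · exact hX

/-- If the walk returns to `ρ` almost surely from every vertex, then by the Markov property it has
no last visit to `ρ`. -/
lemma isRecurrent_of_escape_eq_zero (h : ∀ x, escape G c ρ x = 0) : IsRecurrent G c ρ := by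
  have hnull (n : ℕ) : walkLaw G c ρ {X | ∀ i, n ≤ i → X i ≠ ρ} = 0 := by
    have hmap : Measurable fun X : ℕ → V => X n := measurable_pi_apply n
    have h0 := lintegral_escape (G := G) (c := c) (ρ := ρ) ((walkLaw G c ρ).map fun X => X n)
    simp only [h, lintegral_zero] at h0
    rw [← le_zero_iff, h0]
    refine le_iInf fun k => (measure_forall_ne_le n k n le_rfl).trans ?_
    rw [lintegral_map .of_discrete hmap]
    refine lintegral_mono fun X => ?_
    exact mul_le_of_le_one_left zero_le (Set.indicator_le_self' (fun _ _ => zero_le) X)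
  have hae : ∀ᵐ X ∂(walkLaw G c ρ), ∀ n, ∃ i, n ≤ i ∧ X i = ρ := by
    rw [ae_all_iff]
    intro n
    rw [ae_iff]
    simpa using hnull n
  filter_upwards [hae] with X hX
  refine Set.infinite_of_not_bddAbove fun ⟨b, hb⟩ => ?_
  obtain ⟨i, hi, hXi⟩ := hX (b + 1)
  have := hb (Set.mem_ofPred.2 hXi)
  omega

/-! ### The transition kernel at a vertex of finite degree -/

/-- The average of `g` over the next position of the walk, as a weighted mean over the
neighbours. -/
lemma sum_mul_lintegral_stepKernel [G.LocallyFinite] (x : V)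
    (h0 : ∑ y ∈ G.neighborFinset x, c s(x, y) ≠ 0)
    (htop : ∑ y ∈ G.neighborFinset x, c s(x, y) ≠ ∞) (g : V → ℝ≥0∞) :
    (∑ y ∈ G.neighborFinset x, c s(x, y)) * ∫⁻ y, g y ∂(stepKernel G c x) =
      ∑ y ∈ G.neighborFinset x, c s(x, y) * g y := by
  have hsum (g : V → ℝ≥0∞) : ∑' y, edgeCond G c x y * g y =
      ∑ y ∈ G.neighborFinset x, c s(x, y) * g y := by
    rw [tsum_eq_sum (s := G.neighborFinset x)]
    · refine Finset.sum_congr rfl fun y hy => ?_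
      rw [edgeCond, if_pos ((G.mem_neighborFinset x y).1 hy)]
    · intro y hy
      rw [edgeCond, if_neg (mt (G.mem_neighborFinset x y).2 hy), zero_mul]
  have hS : ∑' y, edgeCond G c x y = ∑ y ∈ G.neighborFinset x, c s(x, y) := by
    simpa using hsum fun _ => 1
  have hp (p : PMF V) : ∫⁻ y, g y ∂p.toMeasure = ∑' y, p y * g y := by
    have : p.toMeasure = Measure.sum fun y => p y • Measure.dirac y := by
      ext s hs
      rw [PMF.toMeasure_apply _ hs, Measure.sum_apply _ hs]
      refine tsum_congr fun y => ?_
      rw [Measure.smul_apply, Measure.dirac_apply' _ hs]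
      by_cases hy : y ∈ s <;> simp [hy]
    rw [this, lintegral_sum_measure]
    simp [lintegral_smul_measure, lintegral_dirac' _ (Measurable.of_discrete (f := g))]
  change _ * ∫⁻ y, g y ∂(step G c x).toMeasure = _
  rw [hp, step, dif_pos ⟨hS ▸ h0, hS ▸ htop⟩, ← hsum, ← ENNReal.tsum_mul_left]
  refine tsum_congr fun y => ?_
  rw [PMF.normalize_apply, hS, mul_right_comm, mul_left_comm, ENNReal.mul_inv_cancel h0 htop,
    mul_one]

end Walk

section Conductances

/-! ### Averages for the conductances `exp (-|e| ^ l)` -/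

/-- The conductance of the edge from `x` to its parent, as a real number. -/
noncomputable def cond (G : SimpleGraph V) (ρ : V) (l : ℝ) (x : V) : ℝ :=
  Real.exp (-(G.dist ρ x : ℝ) ^ l)

lemma cond_pos (l : ℝ) (x : V) : 0 < cond G ρ l x := Real.exp_pos _

lemma weight_edgeTo (hG : G.IsTree) (l : ℝ) (x : V) :
    weight G ρ l (edgeTo G ρ x) = ENNReal.ofReal (cond G ρ l x) := by
  rw [weight, edgeDepth_edgeTo hG, cond]

variable [G.LocallyFinite]

lemma weight_of_mem_children (hG : G.IsTree) (l : ℝ) {x y : V} (h : y ∈ children G ρ x) :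
    weight G ρ l s(x, y) = ENNReal.ofReal (cond G ρ l y) := by
  rw [← weight_edgeTo hG, edgeTo, ((mem_children hG).1 h).2]

lemma sum_neighborFinset_root (hG : G.IsTree) (l : ℝ) (g : V → ℝ≥0∞) :
    ∑ y ∈ G.neighborFinset ρ, weight G ρ l s(ρ, y) * g y =
      ∑ y ∈ children G ρ ρ, ENNReal.ofReal (cond G ρ l y) * g y := by
  rw [neighborFinset_root hG]
  exact Finset.sum_congr rfl fun y hy => by rw [weight_of_mem_children hG l hy]

lemma sum_neighborFinset (hG : G.IsTree) (l : ℝ) {x : V} (hx : x ≠ ρ) (g : V → ℝ≥0∞) :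
    ∑ y ∈ G.neighborFinset x, weight G ρ l s(x, y) * g y =
      ENNReal.ofReal (cond G ρ l x) * g (parent G ρ x) +
        ∑ y ∈ children G ρ x, ENNReal.ofReal (cond G ρ l y) * g y := by
  rw [neighborFinset_eq_cons hG hx, Finset.sum_cons, Sym2.eq_swap]
  congr 1
  · rw [← weight_edgeTo hG, edgeTo]
  · exact Finset.sum_congr rfl fun y hy => by rw [weight_of_mem_children hG l hy]

lemma sum_weight_ne_top (l : ℝ) (x : V) :
    ∑ y ∈ G.neighborFinset x, weight G ρ l s(x, y) ≠ ∞ :=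
  ENNReal.sum_ne_top.2 fun _ _ => ENNReal.ofReal_ne_top

lemma sum_weight_ne_zero [Nontrivial V] (hG : G.IsTree) (l : ℝ) (x : V) :
    ∑ y ∈ G.neighborFinset x, weight G ρ l s(x, y) ≠ 0 := by
  obtain ⟨y, hy⟩ := hG.connected.preconnected.exists_adj_of_nontrivial x
  rw [Ne, Finset.sum_eq_zero_iff]
  intro h
  have := h y ((G.mem_neighborFinset x y).2 hy)
  rw [weight, ENNReal.ofReal_eq_zero] at this
  exact absurd (Real.exp_pos _) this.not_gt

/-! ### Flows and cutsets -/

/-- A nonnegative flow bounded by the conductances has strength at most the total conductance of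
any cutset: otherwise one could follow, from the root to infinity, vertices into which more flows
than the part of the cutset in their subtree can carry, and no edge of the resulting ray would lie
in the cutset. -/
lemma sum_flow_le_cutset (hG : G.IsTree) (l : ℝ) {θ : V → ℝ} (hθ : ∀ x, 0 ≤ θ x)
    (hθc : ∀ x, θ x ≤ cond G ρ l x) (hsum : ∀ x ≠ ρ, θ x = ∑ y ∈ children G ρ x, θ y)
    {π : Set (Sym2 V)} (hπ : IsCutset G ρ π) :
    ENNReal.ofReal (∑ y ∈ children G ρ ρ, θ y) ≤ ∑' e : π, weight G ρ l e := by
  obtain ⟨C, hC, rfl⟩ : ∃ C ⊆ ({ρ}ᶜ : Set V), edgeTo G ρ '' C = π := by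
    rw [← Set.subset_image_iff, ← edgeSet_eq_image hG]
    exact hπ.1
  rw [isCutset_image_iff hG hC] at hπ
  rw [tsum_edgeTo_image hG hC]
  set w : V → ℝ≥0∞ := C.indicator fun x => weight G ρ l (edgeTo G ρ x) with hw
  have hwC : ∀ x ∈ C, w x = ENNReal.ofReal (cond G ρ l x) := fun x hx => by
    rw [hw, Set.indicator_of_mem hx, weight_edgeTo hG]
  by_contra! hlt
  have hchild : ∀ x, subtreeSum G ρ w x < ENNReal.ofReal (∑ y ∈ children G ρ x, θ y) →
      ∃ y ∈ children G ρ x, subtreeSum G ρ w y < ENNReal.ofReal (θ y) := by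
    intro x hx
    rw [ENNReal.ofReal_sum_of_nonneg fun y _ => hθ y] at hx
    refine Finset.exists_lt_of_sum_lt (lt_of_le_of_lt ?_ hx)
    rw [subtreeSum_eq hG w x]
    exact le_add_self
  let S := {x : V // subtreeSum G ρ w x < ENNReal.ofReal (∑ y ∈ children G ρ x, θ y)}
  have hnext : ∀ x : S, ∃ y : S, y.1 ∈ children G ρ x.1 ∧
      subtreeSum G ρ w y.1 < ENNReal.ofReal (θ y.1) := by
    rintro ⟨x, hx⟩
    obtain ⟨y, hy, hlt'⟩ := hchild x hx
    refine ⟨⟨y, ?_⟩, hy, hlt'⟩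
    rwa [← hsum y ((mem_children hG).1 hy).1]
  choose next hnext1 hnext2 using hnext
  let F : ℕ → S := fun n => next^[n] ⟨ρ, hlt⟩
  have hF : ∀ n, F (n + 1) = next (F n) := fun n => Function.iterate_succ_apply' _ _ _
  have hray : IsRay G ρ fun n => (F n).1 :=
    isRay_of_mem_children rfl fun n => by rw [hF]; exact hnext1 _
  obtain ⟨n, hn, -⟩ := hπ _ hray
  have h1 := hnext2 (F n)
  rw [← hF, subtreeSum_eq hG, hwC _ hn] at h1
  exact absurd ((le_self_add.trans_lt h1).trans_le (ENNReal.ofReal_le_ofReal (hθc _)))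
    (lt_irrefl _)

variable [MeasurableSpace V] [DiscreteMeasurableSpace V] [Nontrivial V]

lemma sum_weight_mul_lintegral (hG : G.IsTree) (l : ℝ) (x : V) (g : V → ℝ≥0∞) :
    (∑ y ∈ G.neighborFinset x, weight G ρ l s(x, y)) *
        ∫⁻ y, g y ∂(stepKernel G (weight G ρ l) x) =
      ∑ y ∈ G.neighborFinset x, weight G ρ l s(x, y) * g y :=
  sum_mul_lintegral_stepKernel x (sum_weight_ne_zero hG l x) (sum_weight_ne_top l x) g

lemma le_lintegral_step (hG : G.IsTree) (l : ℝ) (x : V) {a : ℝ≥0∞} {g : V → ℝ≥0∞}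
    (h : ∀ y ∈ G.neighborFinset x, a ≤ g y) :
    a ≤ ∫⁻ y, g y ∂(stepKernel G (weight G ρ l) x) := by
  rw [← ENNReal.mul_le_mul_iff_right (sum_weight_ne_zero (ρ := ρ) hG l x) (sum_weight_ne_top l x),
    sum_weight_mul_lintegral hG, Finset.sum_mul]
  exact Finset.sum_le_sum fun y hy => mul_le_mul_right (h y hy) _

/-! ### Recurrence from small cutsets -/

/-- The probability of not visiting the root grows along rays: to reach the root from `x`, the
walk has to pass through the parent of `x`. -/
lemma noVisit_parent_le (hG : G.IsTree) (l : ℝ) (n : ℕ) (x : V) :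
    noVisit G (weight G ρ l) ρ n (parent G ρ x) ≤ noVisit G (weight G ρ l) ρ n x := by
  induction n generalizing x with
  | zero =>
    by_cases hx : x = ρ
    · rw [hx, parent_root]
    · refine (noVisit_le_one 0 _).trans ?_
      simp [noVisit, hx]
  | succ n ih =>
    by_cases hx : x = ρ
    · rw [hx, parent_root]
    · refine (noVisit_succ_le n _).trans ?_
      rw [noVisit_succ n hx]
      refine le_lintegral_step hG l x fun y hy => ?_
      rw [neighborFinset_eq_cons hG hx, Finset.mem_cons] at hy
      rcases hy with rfl | hy
      · exact le_rfl
      · refine (ih x).trans ?_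
        rw [← ((mem_children hG).1 hy).2]
        exact ih y

/-- The current that flows from the parent of `x` to `x` when the voltage is the probability of
escape to infinity. -/
noncomputable def escapeFlow (G : SimpleGraph V) (ρ : V) (l : ℝ) (x : V) : ℝ :=
  cond G ρ l x * ((escape G (weight G ρ l) ρ x).toReal -
    (escape G (weight G ρ l) ρ (parent G ρ x)).toReal)

lemma escapeFlow_nonneg (hG : G.IsTree) (l : ℝ) (x : V) : 0 ≤ escapeFlow G ρ l x := by
  refine mul_nonneg (cond_pos l x).le (sub_nonneg.2 ?_)
  exact ENNReal.toReal_mono (escape_ne_top x) (iInf_mono fun n => noVisit_parent_le hG l n x)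

omit [G.LocallyFinite] [Nontrivial V] in
lemma escapeFlow_le_cond (l : ℝ) (x : V) : escapeFlow G ρ l x ≤ cond G ρ l x := by
  refine mul_le_of_le_one_right (cond_pos l x).le ?_
  have h1 : (escape G (weight G ρ l) ρ x).toReal ≤ 1 :=
    ENNReal.toReal_mono ENNReal.one_ne_top (escape_le_one x)
  have h2 : 0 ≤ (escape G (weight G ρ l) ρ (parent G ρ x)).toReal := ENNReal.toReal_nonneg
  linarith

/-- Kirchhoff's node law. -/
lemma escapeFlow_eq_sum (hG : G.IsTree) (l : ℝ) {x : V} (hx : x ≠ ρ) :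
    escapeFlow G ρ l x = ∑ y ∈ children G ρ x, escapeFlow G ρ l y := by
  have h := sum_weight_mul_lintegral (ρ := ρ) hG l x (escape G (weight G ρ l) ρ)
  have h1 := sum_neighborFinset hG l hx fun _ => 1
  simp only [mul_one] at h1
  rw [lintegral_escape_eq hx, sum_neighborFinset hG l hx, h1] at h
  have h2 := congrArg ENNReal.toReal h
  have hfin : ∀ y, ENNReal.ofReal (cond G ρ l y) * escape G (weight G ρ l) ρ y ≠ ∞ :=
    fun y => ENNReal.mul_ne_top ENNReal.ofReal_ne_top (escape_ne_top y)
  rw [ENNReal.toReal_mul, ENNReal.toReal_add ENNReal.ofReal_ne_top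
    (ENNReal.sum_ne_top.2 fun _ _ => ENNReal.ofReal_ne_top), ENNReal.toReal_add
    (ENNReal.mul_ne_top ENNReal.ofReal_ne_top (escape_ne_top _))
    (ENNReal.sum_ne_top.2 fun y _ => hfin y), ENNReal.toReal_sum fun _ _ => ENNReal.ofReal_ne_top,
    ENNReal.toReal_sum fun y _ => hfin y] at h2
  simp only [ENNReal.toReal_mul, ENNReal.toReal_ofReal (cond_pos l _).le] at h2
  have h3 : ∀ y ∈ children G ρ x, escapeFlow G ρ l y =
      cond G ρ l y * (escape G (weight G ρ l) ρ y).toReal -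
        cond G ρ l y * (escape G (weight G ρ l) ρ x).toReal := by
    intro y hy
    rw [escapeFlow, ((mem_children hG).1 hy).2, mul_sub]
  rw [Finset.sum_congr rfl h3, Finset.sum_sub_distrib, ← Finset.sum_mul, escapeFlow]
  linarith

/-- The criterion of Nash-Williams for a tree. -/
lemma isRecurrent_of_cutsetInf_eq_zero (hG : G.IsTree) (l : ℝ) (h : cutsetInf G ρ l = 0) :
    IsRecurrent G (weight G ρ l) ρ := by
  apply isRecurrent_of_escape_eq_zero
  have hroot : ∑ y ∈ children G ρ ρ, escapeFlow G ρ l y = 0 := by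
    refine le_antisymm ?_ (Finset.sum_nonneg fun y _ => escapeFlow_nonneg hG l y)
    rw [← ENNReal.ofReal_eq_zero, ← le_zero_iff, ← h]
    exact le_iInf₂ fun π hπ => sum_flow_le_cutset hG l (escapeFlow_nonneg hG l)
      (escapeFlow_le_cond l) (fun x hx => escapeFlow_eq_sum hG l hx) hπ
  have key : ∀ n x, G.dist ρ x = n → escape G (weight G ρ l) ρ x = 0 ∧
      ∑ y ∈ children G ρ x, escapeFlow G ρ l y = 0 := by
    intro n
    induction n with
    | zero =>
      intro x hx
      rw [eq_root_of_dist_eq_zero hG hx]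
      exact ⟨escape_root, hroot⟩
    | succ n ih =>
      intro x hx
      have hxρ : x ≠ ρ := by rintro rfl; simp at hx
      obtain ⟨h1, h2⟩ := ih (parent G ρ x) (by rw [dist_parent hG, hx]; rfl)
      have h3 : escapeFlow G ρ l x = 0 :=
        (Finset.sum_eq_zero_iff_of_nonneg fun y _ => escapeFlow_nonneg hG l y).1 h2 x
          ((mem_children hG).2 ⟨hxρ, rfl⟩)
      refine ⟨?_, by rw [← escapeFlow_eq_sum hG l hxρ, h3]⟩
      rw [escapeFlow, h1, ENNReal.toReal_zero, sub_zero, mul_eq_zero] at h3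
      exact ((ENNReal.toReal_eq_zero_iff _).1 (h3.resolve_left (cond_pos l x).ne')).resolve_right
        (escape_ne_top x)
  exact fun x => (key _ x rfl).1

end Conductances

/-! ### Flows from cutsets -/

section Flow

variable [G.LocallyFinite]

/-- The maximal amount that can flow from the parent of `x` through the first `n` generations
below `x` if the edges have capacities `cond G ρ l`. -/
noncomputable def capacity (G : SimpleGraph V) [G.LocallyFinite] (ρ : V) (l : ℝ) : ℕ → V → ℝ
  | 0 => cond G ρ l
  | n + 1 => fun x => min (cond G ρ l x) (∑ y ∈ children G ρ x, capacity G ρ l n y)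

lemma capacity_nonneg (l : ℝ) (n : ℕ) (x : V) : 0 ≤ capacity G ρ l n x := by
  induction n generalizing x with
  | zero => exact (cond_pos l x).le
  | succ n ih => exact le_min (cond_pos l x).le (Finset.sum_nonneg fun y _ => ih y)

lemma capacity_le_cond (l : ℝ) (n : ℕ) (x : V) : capacity G ρ l n x ≤ cond G ρ l x := by
  cases n with
  | zero => exact le_rfl
  | succ n => exact min_le_left _ _

lemma capacity_antitone (l : ℝ) (x : V) : Antitone fun n => capacity G ρ l n x := by
  refine antitone_nat_of_succ_le fun n => ?_
  induction n generalizing x with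
  | zero => exact capacity_le_cond l 1 x
  | succ n ih => exact min_le_min_left _ (Finset.sum_le_sum fun y _ => ih y)

/-- The edges that limit the flow through the first `n + 1` generations contain a cutset, formed by
those nearest to the root, and its total conductance is at most that flow. -/
lemma cutsetInf_le_sum_capacity (hG : G.IsTree) (l : ℝ) (n : ℕ) :
    cutsetInf G ρ l ≤ ENNReal.ofReal (∑ y ∈ children G ρ ρ, capacity G ρ l n y) := by
  classical
  -- `D` consists of the vertices whose edge limits the flow below it, and `C` of those of them
  -- that have no proper ancestor in `D`. Iterating `parent` past the root gives `ρ`, which is not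
  -- in `D`.
  set D : Set V := {x | x ≠ ρ ∧ ∃ j, G.dist ρ x + j = n + 1 ∧
    capacity G ρ l j x = cond G ρ l x}
  set C : Set V := {x | x ∈ D ∧ ∀ k, (parent G ρ)^[k + 1] x ∉ D}
  have hC : C ⊆ {ρ}ᶜ := fun x hx => hx.1.1
  have hρD : ρ ∉ D := fun h => h.1 rfl
  have hcut : IsCutset G ρ (edgeTo G ρ '' C) := by
    rw [isCutset_image_iff hG hC]
    intro f hf
    have hex : ∃ m, f (m + 1) ∈ D := by
      refine ⟨n, ((mem_children hG).1 (hf.dist_eq hG n).2).1, 0, ?_, rfl⟩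
      simpa using (hf.dist_eq hG (n + 1)).1
    refine ⟨Nat.find hex, ⟨Nat.find_spec hex, fun k => ?_⟩, ?_⟩
    · rcases lt_or_ge k (Nat.find hex) with hk | hk
      · obtain ⟨i, hi⟩ : ∃ i, Nat.find hex = i + (k + 1) :=
          ⟨Nat.find hex - (k + 1), by omega⟩
        have h1 := hf.iterate_parent hG (i + 1) (k + 1)
        rw [show i + 1 + (k + 1) = Nat.find hex + 1 by omega] at h1
        rw [h1]
        exact Nat.find_min hex (by omega)
      · rw [eq_root_of_dist_eq_zero hG (x := (parent G ρ)^[k + 1] (f (Nat.find hex + 1)))]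
        · exact hρD
        · rw [dist_iterate_parent hG, (hf.dist_eq hG _).1]
          omega
    · intro b hb
      have h1 : Nat.find hex ≤ b := Nat.find_min' hex hb.1
      by_contra hne
      exact hb.2 (b - Nat.find hex - 1) (by
        have h2 := hf.iterate_parent hG (Nat.find hex + 1) (b - Nat.find hex - 1 + 1)
        rw [show Nat.find hex + 1 + (b - Nat.find hex - 1 + 1) = b + 1 by omega] at h2
        rw [h2]
        exact Nat.find_spec hex)
  set w : V → ℝ≥0∞ := C.indicator fun x => weight G ρ l (edgeTo G ρ x) with hw
  -- Below a vertex of `D`, there is no vertex of `C`.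
  have hmem : ∀ j x, x ∈ D → G.dist ρ x + j = n + 1 →
      subtreeSum G ρ w x ≤ ENNReal.ofReal (capacity G ρ l j x) := by
    intro j x hxD hj
    obtain ⟨i, hi, hcap⟩ := hxD.2
    obtain rfl : i = j := by omega
    rw [subtreeSum_eq hG, Finset.sum_eq_zero, add_zero, hcap, ← weight_edgeTo hG]
    · exact Set.indicator_le_self' (fun _ _ => zero_le) x
    · intro y hy
      rw [subtreeSum, ENNReal.tsum_eq_zero]
      intro z
      refine Set.indicator_apply_eq_zero.2 fun hz => Set.indicator_of_notMem (fun hzC => ?_) _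
      refine hzC.2 (G.dist ρ z - G.dist ρ y) ?_
      rw [Function.iterate_succ_apply', Set.mem_ofPred.1 hz, ((mem_children hG).1 hy).2]
      exact hxD
  have key : ∀ j x, x ≠ ρ → G.dist ρ x + j = n + 1 → (∀ k, (parent G ρ)^[k + 1] x ∉ D) →
      subtreeSum G ρ w x ≤ ENNReal.ofReal (capacity G ρ l j x) := by
    intro j
    induction j with
    | zero => exact fun x hx hj hanc => hmem 0 x ⟨hx, 0, hj, rfl⟩ hj
    | succ j ih =>
      intro x hx hj hanc
      by_cases hxD : x ∈ D
      · exact hmem (j + 1) x hxD hj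
      have hne : capacity G ρ l (j + 1) x ≠ cond G ρ l x := fun h => hxD ⟨hx, j + 1, hj, h⟩
      have hcap : capacity G ρ l (j + 1) x = ∑ y ∈ children G ρ x, capacity G ρ l j y :=
        (min_choice _ _).resolve_left hne
      rw [subtreeSum_eq hG, hw, Set.indicator_of_notMem fun h => hxD h.1, zero_add, hcap,
        ENNReal.ofReal_sum_of_nonneg fun y _ => capacity_nonneg l j y]
      refine Finset.sum_le_sum fun y hy => ih y ((mem_children hG).1 hy).1 ?_ fun k => ?_
      · rw [dist_of_mem_children hy]; omega
      · rw [Function.iterate_succ_apply, ((mem_children hG).1 hy).2]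
        cases k with
        | zero => exact hxD
        | succ k => exact hanc k
  refine (iInf₂_le _ hcut).trans ?_
  rw [tsum_edgeTo_image hG hC, subtreeSum_eq hG, Set.indicator_of_notMem (fun h => hρD h.1),
    zero_add, ENNReal.ofReal_sum_of_nonneg fun y _ => capacity_nonneg l n y]
  refine Finset.sum_le_sum fun y hy => key n y ((mem_children hG).1 hy).1 ?_ fun k => ?_
  · rw [dist_of_mem_children hy, SimpleGraph.dist_self]; omega
  · rw [eq_root_of_dist_eq_zero hG (x := (parent G ρ)^[k + 1] y)]
    · exact hρD
    · rw [dist_iterate_parent hG, dist_of_mem_children hy, SimpleGraph.dist_self]; omega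

omit [G.LocallyFinite] in
/-- Functions on a tree can be defined by recursion along the path from the root. -/
lemma exists_eq_of_parent (hG : G.IsTree) (a : ℝ) (F : V → ℝ → ℝ) :
    ∃ θ : V → ℝ, θ ρ = a ∧ ∀ x ≠ ρ, θ x = F x (θ (parent G ρ x)) := by
  let Θ : ℕ → V → ℝ := fun n => Nat.rec (fun _ => a) (fun _ g x => F x (g (parent G ρ x))) n
  refine ⟨fun x => Θ (G.dist ρ x) x, by simp [Θ], fun x hx => ?_⟩
  simp only [(parent_spec hG hx).2, Θ]

/-- A nonnegative function `m` whose value at each `x` is at most the sum of its values at the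
children of `x` dominates a flow: split what arrives at `x` among the children in proportion
to `m`. -/
lemma exists_flow_le (hG : G.IsTree) {m : V → ℝ} (hm : ∀ x, 0 ≤ m x)
    (hle : ∀ x, m x ≤ ∑ y ∈ children G ρ x, m y) :
    ∃ θ : V → ℝ, (∀ x, 0 ≤ θ x) ∧ (∀ x ≠ ρ, θ x ≤ m x) ∧
      (∀ x, θ x = ∑ y ∈ children G ρ x, θ y) ∧ θ ρ = ∑ y ∈ children G ρ ρ, m y := by
  obtain ⟨θ, h0, h⟩ := exists_eq_of_parent (ρ := ρ) hG (∑ y ∈ children G ρ ρ, m y)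
    fun x t => t * (m x / ∑ y ∈ children G ρ (parent G ρ x), m y)
  have hS : ∀ x, 0 ≤ ∑ y ∈ children G ρ x, m y := fun x => Finset.sum_nonneg fun y _ => hm y
  have hstep : ∀ x ≠ ρ, 0 ≤ θ (parent G ρ x) →
      θ (parent G ρ x) ≤ ∑ y ∈ children G ρ (parent G ρ x), m y → 0 ≤ θ x ∧ θ x ≤ m x := by
    intro x hx h1 h2
    rw [h x hx]
    refine ⟨mul_nonneg h1 (div_nonneg (hm x) (hS _)), ?_⟩
    rw [mul_div_left_comm]
    exact mul_le_of_le_one_right (hm x) (div_le_one_of_le₀ h2 (hS _))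
  have hbound : ∀ n x, G.dist ρ x = n → 0 ≤ θ x ∧ θ x ≤ ∑ y ∈ children G ρ x, m y := by
    intro n
    induction n with
    | zero =>
      intro x hx
      rw [eq_root_of_dist_eq_zero hG hx, h0]
      exact ⟨hS ρ, le_rfl⟩
    | succ n ih =>
      intro x hx
      have hxρ : x ≠ ρ := by rintro rfl; simp at hx
      obtain ⟨h1, h2⟩ := ih (parent G ρ x) (by rw [dist_parent hG, hx]; rfl)
      obtain ⟨h3, h4⟩ := hstep x hxρ h1 h2
      exact ⟨h3, h4.trans (hle x)⟩
  refine ⟨θ, fun x => (hbound _ x rfl).1, fun x hx => ?_, fun x => ?_, h0⟩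
  · exact (hstep x hx (hbound _ _ rfl).1 (hbound _ _ rfl).2).2
  · have h1 : ∀ y ∈ children G ρ x, θ y = θ x * (m y / ∑ z ∈ children G ρ x, m z) := by
      intro y hy
      obtain ⟨hy1, hy2⟩ := (mem_children hG).1 hy
      rw [h y hy1, hy2]
    rw [Finset.sum_congr rfl h1, ← Finset.mul_sum, ← Finset.sum_div]
    by_cases h2 : ∑ z ∈ children G ρ x, m z = 0
    · have := hbound _ x rfl
      rw [h2] at this
      rw [le_antisymm this.2 this.1, zero_mul]
    · rw [div_self h2, mul_one]

/-- The max-flow min-cut theorem for a tree, with a flow to infinity. -/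
lemma exists_flow_of_cutsetInf_pos (hG : G.IsTree) (l : ℝ) (h : 0 < cutsetInf G ρ l) :
    ∃ θ : V → ℝ, (∀ x, 0 ≤ θ x) ∧ (∀ x ≠ ρ, θ x ≤ cond G ρ l x) ∧
      (∀ x, θ x = ∑ y ∈ children G ρ x, θ y) ∧ 0 < θ ρ := by
  have hlim : ∀ x, Filter.Tendsto (fun n => capacity G ρ l n x) Filter.atTop
      (nhds (⨅ n, capacity G ρ l n x)) := fun x =>
    tendsto_atTop_ciInf (capacity_antitone l x)
      ⟨0, by rintro _ ⟨n, rfl⟩; exact capacity_nonneg l n x⟩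
  set m : V → ℝ := fun x => ⨅ n, capacity G ρ l n x with hmdef
  have hm : ∀ x, 0 ≤ m x := fun x => le_ciInf fun n => capacity_nonneg l n x
  have hle : ∀ x, m x ≤ ∑ y ∈ children G ρ x, m y := fun x =>
    le_of_tendsto_of_tendsto' ((hlim x).comp (Filter.tendsto_add_atTop_nat 1))
      (tendsto_finsetSum _ fun y _ => hlim y) fun n => min_le_right _ _
  obtain ⟨θ, h1, h2, h3, h4⟩ := exists_flow_le (ρ := ρ) hG hm hle
  refine ⟨θ, h1, fun x hx => (h2 x hx).trans ?_, h3, ?_⟩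
  · exact ciInf_le_of_le ⟨0, by rintro _ ⟨n, rfl⟩; exact capacity_nonneg l n x⟩ 0 le_rfl
  · rw [h4, ← ENNReal.ofReal_pos]
    have h5 := (ENNReal.continuous_ofReal.tendsto _).comp
      (tendsto_finsetSum (children G ρ ρ) fun y _ => hlim y)
    exact h.trans_le (ge_of_tendsto' h5 fun n => cutsetInf_le_sum_capacity hG l n)

end Flow

section Transience

/-! ### Transience from a bounded potential -/

lemma summable_exp_rpow_sub_rpow {l l' : ℝ} (hl' : 0 < l') (h : l < l') :
    Summable fun n : ℕ => Real.exp ((n : ℝ) ^ l - (n : ℝ) ^ l') := by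
  have h1 : ∀ᶠ x : ℝ in Filter.atTop, x ^ l ≤ 1 / 2 * x ^ l' := by
    filter_upwards [(tendsto_rpow_atTop (sub_pos.2 h)).eventually_ge_atTop 2,
      Filter.eventually_gt_atTop 0] with x hx hx0
    have h2 : x ^ l' = x ^ l * x ^ (l' - l) := by rw [← Real.rpow_add hx0]; ring_nf
    have h3 : 0 ≤ x ^ l := (Real.rpow_pos_of_pos hx0 l).le
    rw [h2]
    nlinarith
  have h2 : (fun n : ℕ => Real.exp ((n : ℝ) ^ l - (n : ℝ) ^ l')) =O[Filter.atTop]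
      fun n : ℕ => (n : ℝ) ^ (-2 : ℝ) := by
    have h3 := (isLittleO_exp_neg_mul_rpow_atTop (a := 1 / 2) (by norm_num)
      (-2 / l')).isBigO.comp_tendsto ((tendsto_rpow_atTop hl').comp tendsto_natCast_atTop_atTop)
    refine (Asymptotics.IsBigO.of_bound 1 ?_).trans (h3.congr_right fun n => ?_)
    · filter_upwards [tendsto_natCast_atTop_atTop.eventually h1] with n hn
      simp only [Function.comp_apply, Real.norm_eq_abs, Real.abs_exp, one_mul, Real.exp_le_exp]
      linarith
    · simp only [Function.comp_apply]
      rw [← Real.rpow_mul (Nat.cast_nonneg n), mul_div_cancel₀ _ hl'.ne']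
  exact summable_of_isBigO_nat (Real.summable_nat_rpow.2 (by norm_num)) h2

variable [MeasurableSpace V] [DiscreteMeasurableSpace V] [Nontrivial V] [G.LocallyFinite]

/-- A flow bounded by the conductances of a larger exponent gives transience: its potential, the
sum of flow over conductance along the path from the root, is bounded, harmonic off the root, and
at the root its average over the neighbours exceeds its value. -/
lemma isTransient_of_flow (hG : G.IsTree) {l l' : ℝ} (hl' : 0 < l') (hll' : l < l') {θ : V → ℝ}
    (hθ : ∀ x, 0 ≤ θ x) (hθc : ∀ x ≠ ρ, θ x ≤ cond G ρ l' x)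
    (hsum : ∀ x, θ x = ∑ y ∈ children G ρ x, θ y) (hpos : 0 < θ ρ) :
    IsTransient G (weight G ρ l) ρ := by
  obtain ⟨h, h0, hrec⟩ := exists_eq_of_parent (ρ := ρ) hG 0 fun x t => t + θ x / cond G ρ l x
  -- On level `n`, the edges contribute at most `u n` to `h`, as `θ ≤ cond l'`.
  set u : ℕ → ℝ := fun n => Real.exp ((n : ℝ) ^ l - (n : ℝ) ^ l') with hu
  have hsumm : Summable u := summable_exp_rpow_sub_rpow hl' hll'
  have hpart : ∀ n x, G.dist ρ x = n → h x ≤ ∑ k ∈ Finset.range (n + 1), u k := by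
    intro n
    induction n with
    | zero =>
      intro x hx
      rw [eq_root_of_dist_eq_zero hG hx, h0]
      exact Finset.sum_nonneg fun k _ => (Real.exp_pos _).le
    | succ n ih =>
      intro x hx
      have hxρ : x ≠ ρ := by rintro rfl; simp at hx
      rw [hrec x hxρ, Finset.sum_range_succ]
      refine add_le_add (ih _ (by rw [dist_parent hG, hx]; rfl)) ?_
      rw [div_le_iff₀ (cond_pos l x)]
      refine (hθc x hxρ).trans_eq ?_
      rw [hu, cond, cond, ← Real.exp_add, hx]
      ring_nf
  set B : ℝ := ∑' n, u n
  have hhB : ∀ x, 0 ≤ B - h x := fun x => sub_nonneg.2 <|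
    (hpart _ x rfl).trans (hsumm.sum_le_tsum _ fun k _ => (Real.exp_pos _).le)
  have hchild : ∀ x, ∑ y ∈ children G ρ x, cond G ρ l y * (B - h y) =
      (∑ y ∈ children G ρ x, cond G ρ l y) * (B - h x) - θ x := by
    intro x
    rw [hsum x, Finset.sum_mul, ← Finset.sum_sub_distrib]
    refine Finset.sum_congr rfl fun y hy => ?_
    obtain ⟨hy1, hy2⟩ := (mem_children hG).1 hy
    rw [hrec y hy1, hy2]
    have := (cond_pos (G := G) (ρ := ρ) l y).ne'
    field_simp
    ring
  have hconv : ∀ x, ∑ y ∈ children G ρ x, ENNReal.ofReal (cond G ρ l y) *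
      ENNReal.ofReal (B - h y) =
        ENNReal.ofReal (∑ y ∈ children G ρ x, cond G ρ l y * (B - h y)) := by
    intro x
    rw [ENNReal.ofReal_sum_of_nonneg fun y _ => mul_nonneg (cond_pos l y).le (hhB y)]
    exact Finset.sum_congr rfl fun y _ => (ENNReal.ofReal_mul (cond_pos l y).le).symm
  have hnn : ∀ x, 0 ≤ ∑ y ∈ children G ρ x, cond G ρ l y :=
    fun x => Finset.sum_nonneg fun y _ => (cond_pos l y).le
  set S := ∑ y ∈ G.neighborFinset ρ, weight G ρ l s(ρ, y)
  have hS0 : S ≠ 0 := sum_weight_ne_zero hG l ρ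
  have hStop : S ≠ ∞ := sum_weight_ne_top l ρ
  refine isTransient_of_superharmonic (fun x => ENNReal.ofReal (B - h x)) ENNReal.ofReal_ne_top
    (ε := ENNReal.ofReal (θ ρ) / S)
    (ENNReal.div_ne_zero.2 ⟨(ENNReal.ofReal_pos.2 hpos).ne', hStop⟩) fun x => ?_
  rw [← ENNReal.mul_le_mul_iff_right (sum_weight_ne_zero (ρ := ρ) hG l x) (sum_weight_ne_top l x),
    mul_add, sum_weight_mul_lintegral hG]
  by_cases hx : x = ρ
  · subst hx
    have h1 := sum_neighborFinset_root (ρ := x) hG l fun _ => 1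
    simp only [mul_one] at h1
    rw [Set.indicator_of_mem (Set.mem_singleton x), ENNReal.mul_div_cancel hS0 hStop,
      sum_neighborFinset_root hG, hconv, h1,
      ← ENNReal.ofReal_sum_of_nonneg fun y _ => (cond_pos l y).le,
      ← ENNReal.ofReal_mul (hnn x), ← ENNReal.ofReal_add (hθ x), hchild]
    · exact ENNReal.ofReal_le_ofReal (by linarith)
    · exact Finset.sum_nonneg fun y _ => mul_nonneg (cond_pos l y).le (hhB y)
  · have h1 := sum_neighborFinset hG l hx fun _ => 1
    simp only [mul_one] at h1
    rw [Set.indicator_of_notMem (by simpa using hx), mul_zero, zero_add, sum_neighborFinset hG l hx,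
      hconv, h1, ← ENNReal.ofReal_sum_of_nonneg fun y _ => (cond_pos l y).le,
      ← ENNReal.ofReal_add (cond_pos l x).le (hnn x), ← ENNReal.ofReal_mul (cond_pos l x).le,
      ← ENNReal.ofReal_mul (add_nonneg (cond_pos l x).le (hnn x)), ← ENNReal.ofReal_add, hchild]
    · refine ENNReal.ofReal_le_ofReal (le_of_eq ?_)
      have h2 : θ x = cond G ρ l x * (h x - h (parent G ρ x)) := by
        rw [hrec x hx]
        have := (cond_pos (G := G) (ρ := ρ) l x).ne'
        field_simp
        ring
      rw [h2]
      ring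
    · exact mul_nonneg (cond_pos l x).le (hhB _)
    · exact Finset.sum_nonneg fun y _ => mul_nonneg (cond_pos l y).le (hhB y)

end Transience

end RootedTree

theorem mainTheorem1 {V : Type*} [Infinite V] [MeasurableSpace V] [DiscreteMeasurableSpace V]
    (G : SimpleGraph V) [G.LocallyFinite] (hG : G.IsTree) (ρ : V) (l : ℝ) :
    (RootedTree.IBN G ρ < ENNReal.ofReal l →
      RootedTree.IsRecurrent G (RootedTree.weight G ρ l) ρ) ∧
    (0 < l → ENNReal.ofReal l < RootedTree.IBN G ρ →
      RootedTree.IsTransient G (RootedTree.weight G ρ l) ρ) := by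
  constructor
  · intro h
    apply RootedTree.isRecurrent_of_cutsetInf_eq_zero hG
    by_contra hne
    have hl : 0 < l := ENNReal.ofReal_pos.1 (zero_le.trans_lt h)
    exact h.not_ge (le_sSup ⟨l, ⟨hl, pos_iff_ne_zero.2 hne⟩, rfl⟩)
  · intro _ h
    obtain ⟨_, ⟨l', ⟨hl', hpos⟩, rfl⟩, hlt⟩ := lt_sSup_iff.1 h
    obtain ⟨θ, h1, h2, h3, h4⟩ := RootedTree.exists_flow_of_cutsetInf_pos hG l' hpos
    exact RootedTree.isTransient_of_flow hG hl'
      ((ENNReal.ofReal_lt_ofReal_iff hl').1 hlt) h1 h2 h3 h4
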